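/- Let $M$ be a von Neumann algebra with unit $\mathbf 1$ and let $\tau$ be a faithful normal semifinite trace on $M$. Let $L_1(M_{sa},\tau)$ be the real Banach space obtained by completing $\{x\in M : x=x^*,\ \tau(|x|)<\infty\}$ in the norm $\|x\|_1=\tau(|x|)$, with its positive cone, the $\|\cdot\|_1$-closure of $\{x\in M: x\ge 0,\ \tau(x)<\infty\}$. A linear operator $T$ on $L_1(M_{sa},\tau)$ is positive if $Tx\ge 0$ whenever $x\ge 0$, and a contraction if $\|Tx\|_1\le\|x\|_1$ for all $x$; for operators, $A\ge B$ means that $A-B$ is positive, and $\|\cdot\|$ is the operator norm. A positive contraction $T$ is called unital if $T^*\mathbf 1=\mathbf 1$, where $T^*$ is the conjugate operator on $M_{sa}=L_1(M_{sa},\tau)^*$ (with $a\in M_{sa}$ acting by $x\mapsto\tau(xa)$); equivalently, $\tau(Tx)=\tau(x)$ for all $x$. Let $d\ge 1$ and let $Z,T_1,\dots,T_d$ be unital positive contractions of $L_1(M_{sa},\tau)$ such that $ZT_i=T_iZ$ and $T_iT_j=T_jT_i$ for all $i,j\in\{1,\dots,d\}$. For $\mathbf n=(n_1,\dots,n_d)\in\mathbb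 N_0^d$, where $\mathbb N_0=\{0,1,2,\dots\}$, put $\mathbf T^{\mathbf n}=T_1^{n_1}\cdots T_d^{n_d}$, and order $\mathbb N_0^d$ coordinatewise. Suppose that there are $\mathbf m,\mathbf k\in\mathbb N_0^d$ and a positive contraction $S$ of $L_1(M_{sa},\tau)$ with $SZ=ZS$ such that $$Z\mathbf T^{\mathbf m+\mathbf k}\ge ZS,\qquad Z\mathbf T^{\mathbf m}\ge ZS,\qquad \|Z(\mathbf T^{\mathbf m+\mathbf k}-S)\|<1,\qquad \|Z(\mathbf T^{\mathbf m}-S)\|<1 .$$ Then for every $\varepsilon>0$ there are an integer $N\ge 1$ and $\mathbf n_0\in\mathbb N_0^d$ such that $$\|Z^{N}(\mathbf T^{\mathbf n+\mathbf k}-\mathbf T^{\mathbf n})\|<\varepsilon\qquad\text{for all } \mathbf n\ge\mathbf n_0 .$$ -/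

import Mathlib

open scoped ENNReal NNReal

/-- A faithful normal semifinite trace on (the positive cone of) a von Neumann algebra `M`.
It is a `[0, ∞]`-valued function on `M₊`; the values of `toFun` at elements that are not positive
carry no meaning and are never used. -/
structure FNSTrace (M : Type*) [CStarAlgebra M] [PartialOrder M] [StarOrderedRing M] where
  /-- The values of the trace. -/
  toFun : M → ℝ≥0∞
  map_add : ∀ x y : M, 0 ≤ x → 0 ≤ y → toFun (x + y) = toFun x + toFun y
  map_smul : ∀ (c : ℝ≥0) (x : M), 0 ≤ x → toFun ((c : ℝ) • x) = c * toFun x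
  tracial : ∀ x : M, toFun (star x * x) = toFun (x * star x)
  faithful : ∀ x : M, 0 ≤ x → toFun x = 0 → x = 0
  /-- Suprema of bounded increasing families of positive elements are preserved. -/
  normal : ∀ (D : Set M) (x : M), D.Nonempty → DirectedOn (· ≤ ·) D → (∀ y ∈ D, 0 ≤ y) →
    IsLUB D x → toFun x = ⨆ y ∈ D, toFun y
  semifinite : ∀ x : M, 0 ≤ x → x ≠ 0 → ∃ y : M, 0 ≤ y ∧ y ≤ x ∧ y ≠ 0 ∧ toFun y < ∞

namespace FNSTrace

variable {M : Type*} [CStarAlgebra M] [PartialOrder M] [StarOrderedRing M] (τ : FNSTrace M)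

theorem map_zero : τ.toFun 0 = 0 := by
  simpa using τ.map_smul 0 0 le_rfl

theorem mono {x y : M} (hx : 0 ≤ x) (hxy : x ≤ y) : τ.toFun x ≤ τ.toFun y := by
  have h := τ.map_add x (y - x) hx (sub_nonneg.2 hxy)
  rw [add_sub_cancel] at h
  rw [h]
  exact le_self_add

/-- The trace does not increase when a positive element is compressed by a self-adjoint `f` with
`f * f ≤ 1`. -/
theorem compress_le {a f : M} (ha : 0 ≤ a) (hf : IsSelfAdjoint f) (hf1 : f * f ≤ 1) :
    τ.toFun (f * a * f) ≤ τ.toFun a := by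
  obtain ⟨b, hb, rfl⟩ : ∃ b : M, IsSelfAdjoint b ∧ b * b = a :=
    ⟨CFC.sqrt a, IsSelfAdjoint.of_nonneg (CFC.sqrt_nonneg a), CFC.sqrt_mul_sqrt_self a ha⟩
  have h1 : f * (b * b) * f = star (b * f) * (b * f) := by
    rw [star_mul, hf.star_eq, hb.star_eq]; noncomm_ring
  have h2 : (b * f) * star (b * f) = star b * (f * f) * b := by
    rw [star_mul, hf.star_eq, hb.star_eq]; noncomm_ring
  rw [h1, τ.tracial, h2]
  have h3 := star_left_conjugate_le_conjugate hf1 b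
  rw [mul_one, hb.star_eq] at h3
  rw [hb.star_eq]
  refine τ.mono ?_ h3
  have h4 := star_left_conjugate_nonneg (mul_self_nonneg_of_sa hf) b
  rwa [hb.star_eq] at h4
where
  mul_self_nonneg_of_sa {f : M} (hf : IsSelfAdjoint f) : 0 ≤ f * f := by
    have := star_mul_self_nonneg f
    rwa [hf.star_eq] at this

/-- Approximations `t ↦ min (n t⁺) 1` of the indicator function of `(0, ∞)`. -/
noncomputable def cutoff (n : ℕ) (t : ℝ) : ℝ := min (n * max t 0) 1

theorem continuous_cutoff (n : ℕ) : Continuous (cutoff n) := by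
  unfold cutoff; fun_prop

theorem cutoff_nonneg (n : ℕ) (t : ℝ) : 0 ≤ cutoff n t := by
  unfold cutoff; positivity

theorem cutoff_le_one (n : ℕ) (t : ℝ) : cutoff n t ≤ 1 := min_le_right _ _

theorem cutoff_of_nonpos (n : ℕ) {t : ℝ} (ht : t ≤ 0) : cutoff n t = 0 := by
  simp [cutoff, max_eq_right ht]

theorem cutoff_mul_nonneg (n : ℕ) (t : ℝ) : 0 ≤ cutoff n t * t * cutoff n t := by
  rcases le_total t 0 with h | h
  · simp [cutoff_of_nonpos n h]
  · have := cutoff_nonneg n t; positivity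

theorem cutoff_mul_le (n : ℕ) (t : ℝ) : cutoff n t * t * cutoff n t ≤ max t 0 := by
  rcases le_total t 0 with h | h
  · simp [cutoff_of_nonpos n h]
  · rw [max_eq_left h]
    nlinarith [cutoff_nonneg n t, cutoff_le_one n t,
      mul_le_one₀ (cutoff_le_one n t) (cutoff_nonneg n t) (cutoff_le_one n t)]

theorem cutoff_mul_mono {n k : ℕ} (hnk : n ≤ k) (t : ℝ) :
    cutoff n t * t * cutoff n t ≤ cutoff k t * t * cutoff k t := by
  rcases le_total t 0 with h | h
  · simp [cutoff_of_nonpos _ h]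
  · have h1 : cutoff n t ≤ cutoff k t := by unfold cutoff; gcongr
    have := cutoff_nonneg n t
    gcongr
    exact mul_nonneg (cutoff_nonneg k t) h

theorem le_cutoff_mul_add {n : ℕ} (hn : 0 < n) (t : ℝ) :
    max t 0 ≤ cutoff n t * t * cutoff n t + (n : ℝ)⁻¹ := by
  have hn' : (0 : ℝ) < n := by exact_mod_cast hn
  rcases le_total t 0 with h | h
  · simp [cutoff_of_nonpos _ h, max_eq_right h]
  · rw [max_eq_left h]
    rcases le_total (n * t) 1 with h1 | h1
    · have h2 : t ≤ (n : ℝ)⁻¹ := by rw [inv_eq_one_div, le_div_iff₀ hn']; linarith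
      have := cutoff_mul_nonneg n t
      linarith
    · have : cutoff n t = 1 := by simp [cutoff, max_eq_left h, h1]
      rw [this]; simp

/-- If `a - b` is a difference of positive elements then `τ ((a - b)⁺) ≤ τ a`. -/
theorem posPart_le {z a b : M} (ha : 0 ≤ a) (hb : 0 ≤ b) (hz : z = a - b) :
    τ.toFun z⁺ ≤ τ.toFun a := by
  have hzs : IsSelfAdjoint z := hz ▸ (IsSelfAdjoint.of_nonneg ha).sub (IsSelfAdjoint.of_nonneg hb)
  set g : ℕ → M := fun n => cfc (cutoff n) z * z * cfc (cutoff n) z with hg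
  have hcont (n : ℕ) : ContinuousOn (cutoff n) (spectrum ℝ z) := (continuous_cutoff n).continuousOn
  have hgc (n : ℕ) : g n = cfc (fun t => cutoff n t * t * cutoff n t) z := by
    rw [cfc_mul (fun t => cutoff n t * t) (cutoff n) z, cfc_mul (cutoff n) (fun t => t) z,
      cfc_id' ℝ z]
  have hcont2 (n : ℕ) : ContinuousOn (fun t => cutoff n t * t * cutoff n t) (spectrum ℝ z) := by
    have := continuous_cutoff n
    fun_prop
  have hpos : z⁺ = cfc (fun t : ℝ => max t 0) z := by
    rw [CFC.posPart_def, cfcₙ_eq_cfc]; rfl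
  have hg0 (n : ℕ) : 0 ≤ g n := by
    rw [hgc]; exact cfc_nonneg fun t _ => cutoff_mul_nonneg n t
  have hlub : IsLUB (Set.range g) z⁺ := by
    constructor
    · rintro _ ⟨n, rfl⟩
      rw [hgc, hpos]
      exact cfc_mono (fun t _ => cutoff_mul_le n t) (hcont2 n)
    · intro u hu
      have h1 : ∀ n : ℕ, z⁺ ≤ u + algebraMap ℝ M ((n + 1 : ℕ) : ℝ)⁻¹ := by
        intro n
        calc z⁺ ≤ cfc (fun t => cutoff (n + 1) t * t * cutoff (n + 1) t + ((n + 1 : ℕ) : ℝ)⁻¹) z := by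
              rw [hpos]
              refine cfc_mono (fun t _ => le_cutoff_mul_add n.succ_pos t) (by fun_prop) ?_
              exact (hcont2 (n + 1)).add continuousOn_const
          _ = g (n + 1) + algebraMap ℝ M ((n + 1 : ℕ) : ℝ)⁻¹ := by
              rw [hgc, cfc_add_const _ _ z (hcont2 (n + 1))]
          _ ≤ _ := by gcongr; exact hu ⟨n + 1, rfl⟩
      have h2 : Filter.Tendsto (fun n : ℕ => u + algebraMap ℝ M ((n + 1 : ℕ) : ℝ)⁻¹)
          Filter.atTop (nhds (u + algebraMap ℝ M 0)) := by
        refine Filter.Tendsto.const_add _ (((continuous_algebraMap ℝ M).tendsto 0).comp ?_)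
        exact (tendsto_inv_atTop_nhds_zero_nat (𝕜 := ℝ)).comp (Filter.tendsto_add_atTop_nat 1)
      rw [_root_.map_zero, add_zero] at h2
      exact ge_of_tendsto' h2 h1
  have hmono : Monotone g := by
    intro n k hnk
    rw [hgc, hgc]
    exact cfc_mono (fun t _ => cutoff_mul_mono hnk t) (hcont2 n) (hcont2 k)
  rw [τ.normal (Set.range g) z⁺ (Set.range_nonempty g)
    (directedOn_range.2 hmono.directed_le) (by rintro _ ⟨n, rfl⟩; exact hg0 n) hlub]
  refine iSup₂_le ?_
  rintro _ ⟨n, rfl⟩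
  set f := cfc (cutoff n) z with hfdef
  have hf : IsSelfAdjoint f := cfc_predicate _ _
  have hff : f * f ≤ 1 := by
    rw [hfdef, ← cfc_mul (cutoff n) (cutoff n) z]
    exact cfc_le_one _ _ fun t _ =>
      mul_le_one₀ (cutoff_le_one n t) (cutoff_nonneg n t) (cutoff_le_one n t)
  have h1 : g n + f * b * f = f * a * f := by
    have hab : a = z + b := by rw [hz]; abel
    change f * z * f + f * b * f = f * a * f
    rw [hab]; noncomm_ring
  calc τ.toFun (g n) ≤ τ.toFun (g n) + τ.toFun (f * b * f) := le_self_add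
    _ = τ.toFun (f * a * f) := by
      rw [← τ.map_add _ _ (hg0 n) (hf.conjugate_nonneg hb), h1]
    _ ≤ τ.toFun a := τ.compress_le ha hf hff

theorem abs_eq {z : M} (hz : IsSelfAdjoint z) :
    τ.toFun (CFC.abs z) = τ.toFun z⁺ + τ.toFun z⁻ := by
  rw [← CFC.posPart_add_negPart z hz, τ.map_add _ _ (CFC.posPart_nonneg z) (CFC.negPart_nonneg z)]

/-- The triangle inequality for `x ↦ τ |x|` on self-adjoint elements. -/
theorem abs_add_le {x y : M} (hx : IsSelfAdjoint x) (hy : IsSelfAdjoint y) :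
    τ.toFun (CFC.abs (x + y)) ≤ τ.toFun (CFC.abs x) + τ.toFun (CFC.abs y) := by
  have hx' := CFC.posPart_sub_negPart x hx
  have hy' := CFC.posPart_sub_negPart y hy
  have px := CFC.posPart_nonneg x
  have py := CFC.posPart_nonneg y
  have nx := CFC.negPart_nonneg x
  have ny := CFC.negPart_nonneg y
  rw [τ.abs_eq (hx.add hy), τ.abs_eq hx, τ.abs_eq hy]
  have h1 : τ.toFun (x + y)⁺ ≤ τ.toFun x⁺ + τ.toFun y⁺ := by
    rw [← τ.map_add _ _ px py]
    refine τ.posPart_le (add_nonneg px py) (add_nonneg nx ny) ?_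
    nth_rewrite 1 [← hx', ← hy']; abel
  have h2 : τ.toFun (x + y)⁻ ≤ τ.toFun x⁻ + τ.toFun y⁻ := by
    rw [← τ.map_add _ _ nx ny, ← CFC.posPart_neg]
    refine τ.posPart_le (add_nonneg nx ny) (add_nonneg px py) ?_
    nth_rewrite 1 [← hx', ← hy']; abel
  calc _ ≤ (τ.toFun x⁺ + τ.toFun y⁺) + (τ.toFun x⁻ + τ.toFun y⁻) := add_le_add h1 h2
    _ = _ := by ring

theorem abs_smul (c : ℝ) (x : M) :
    τ.toFun (CFC.abs (c • x)) = ‖c‖₊ * τ.toFun (CFC.abs x) := by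
  rw [CFC.abs_smul, ← τ.map_smul _ _ (CFC.abs_nonneg x)]; rfl

/-- The real vector space of all self-adjoint `x` in `M` with `τ |x| < ∞`. -/
noncomputable def integrableSA : Submodule ℝ M where
  carrier := {x | IsSelfAdjoint x ∧ τ.toFun (CFC.abs x) < ∞}
  zero_mem' := ⟨IsSelfAdjoint.zero M, by rw [CFC.abs_zero, τ.map_zero]; exact ENNReal.zero_lt_top⟩
  add_mem' := fun {x y} hx hy => ⟨hx.1.add hy.1,
    (τ.abs_add_le hx.1 hy.1).trans_lt (ENNReal.add_lt_top.2 ⟨hx.2, hy.2⟩)⟩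
  smul_mem' := fun c x hx => ⟨(IsSelfAdjoint.all c).smul hx.1, by
    rw [τ.abs_smul]; exact ENNReal.mul_lt_top ENNReal.coe_lt_top hx.2⟩

/-- The space `integrableSA`, to be normed by `‖x‖₁ = τ |x|` and not by the norm of `M`. -/
def PreL1 : Type _ := τ.integrableSA

namespace PreL1

noncomputable instance : AddCommGroup τ.PreL1 := inferInstanceAs (AddCommGroup τ.integrableSA)

noncomputable instance : Module ℝ τ.PreL1 := inferInstanceAs (Module ℝ τ.integrableSA)

/-- The underlying element of `M`. -/
noncomputable def val : τ.PreL1 →ₗ[ℝ] M := τ.integrableSA.subtype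

variable {τ}

theorem isSelfAdjoint (x : τ.PreL1) : IsSelfAdjoint (val τ x) := x.2.1

theorem abs_lt_top (x : τ.PreL1) : τ.toFun (CFC.abs (val τ x)) < ∞ := x.2.2

noncomputable instance : Norm τ.PreL1 := ⟨fun x => (τ.toFun (CFC.abs (val τ x))).toReal⟩

theorem norm_def (x : τ.PreL1) : ‖x‖ = (τ.toFun (CFC.abs (val τ x))).toReal := rfl

theorem normCore : NormedSpace.Core ℝ τ.PreL1 where
  norm_nonneg _ := ENNReal.toReal_nonneg
  norm_smul c x := by
    rw [norm_def, norm_def, _root_.map_smul, τ.abs_smul, ENNReal.toReal_mul]; simp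
  norm_triangle x y := by
    rw [norm_def, norm_def, norm_def, _root_.map_add,
      ← ENNReal.toReal_add x.abs_lt_top.ne y.abs_lt_top.ne]
    exact ENNReal.toReal_mono (ENNReal.add_lt_top.2 ⟨x.abs_lt_top, y.abs_lt_top⟩).ne
      (τ.abs_add_le x.isSelfAdjoint y.isSelfAdjoint)
  norm_eq_zero_iff x := by
    rw [norm_def, ENNReal.toReal_eq_zero_iff, or_iff_left x.abs_lt_top.ne]
    constructor
    · intro h
      have h0 := τ.faithful _ (CFC.abs_nonneg _) h
      rw [CFC.abs_eq_zero_iff] at h0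
      exact Subtype.ext h0
    · rintro rfl
      rw [_root_.map_zero, CFC.abs_zero, τ.map_zero]

noncomputable instance : NormedAddCommGroup τ.PreL1 := NormedAddCommGroup.ofCore normCore

noncomputable instance : NormedSpace ℝ τ.PreL1 := NormedSpace.ofCore normCore

theorem posPart_lt_top (x : τ.PreL1) : τ.toFun (val τ x)⁺ < ∞ :=
  lt_of_le_of_lt (by rw [τ.abs_eq x.isSelfAdjoint]; exact le_self_add) x.abs_lt_top

theorem negPart_lt_top (x : τ.PreL1) : τ.toFun (val τ x)⁻ < ∞ :=
  lt_of_le_of_lt (by rw [τ.abs_eq x.isSelfAdjoint]; exact le_add_self) x.abs_lt_top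

/-- The trace of a self-adjoint element with `τ |x| < ∞`: `τ x = τ (x⁺) - τ (x⁻)`. -/
noncomputable def traceFun (x : τ.PreL1) : ℝ :=
  (τ.toFun (val τ x)⁺).toReal - (τ.toFun (val τ x)⁻).toReal

theorem traceFun_eq (x : τ.PreL1) {a b : M} (ha : 0 ≤ a) (hb : 0 ≤ b) (ha' : τ.toFun a < ∞)
    (hb' : τ.toFun b < ∞) (h : val τ x = a - b) :
    traceFun x = (τ.toFun a).toReal - (τ.toFun b).toReal := by
  have h1 : (val τ x)⁺ + b = a + (val τ x)⁻ := by
    have h2 := CFC.posPart_sub_negPart (val τ x) x.isSelfAdjoint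
    have h3 : (val τ x)⁺ - (val τ x)⁻ = a - b := h2.trans h
    rw [sub_eq_sub_iff_add_eq_add] at h3
    exact h3
  have h4 := congrArg τ.toFun h1
  rw [τ.map_add _ _ (CFC.posPart_nonneg _) hb, τ.map_add _ _ ha (CFC.negPart_nonneg _)] at h4
  have h5 := congrArg ENNReal.toReal h4
  rw [ENNReal.toReal_add x.posPart_lt_top.ne hb'.ne,
    ENNReal.toReal_add ha'.ne x.negPart_lt_top.ne] at h5
  unfold traceFun
  linarith

theorem traceFun_add (x y : τ.PreL1) : traceFun (x + y) = traceFun x + traceFun y := by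
  have px := CFC.posPart_nonneg (val τ x)
  have py := CFC.posPart_nonneg (val τ y)
  have nx := CFC.negPart_nonneg (val τ x)
  have ny := CFC.negPart_nonneg (val τ y)
  rw [traceFun_eq (x + y) (add_nonneg px py) (add_nonneg nx ny)
    (by rw [τ.map_add _ _ px py]; exact ENNReal.add_lt_top.2 ⟨x.posPart_lt_top, y.posPart_lt_top⟩)
    (by rw [τ.map_add _ _ nx ny]; exact ENNReal.add_lt_top.2 ⟨x.negPart_lt_top, y.negPart_lt_top⟩),
    τ.map_add _ _ px py, τ.map_add _ _ nx ny,
    ENNReal.toReal_add x.posPart_lt_top.ne y.posPart_lt_top.ne,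
    ENNReal.toReal_add x.negPart_lt_top.ne y.negPart_lt_top.ne]
  · unfold traceFun; ring
  · rw [_root_.map_add]
    nth_rewrite 1 [← CFC.posPart_sub_negPart (val τ x) x.isSelfAdjoint,
      ← CFC.posPart_sub_negPart (val τ y) y.isSelfAdjoint]
    abel

theorem abs_traceFun_le (x : τ.PreL1) : |traceFun x| ≤ ‖x‖ := by
  rw [norm_def, τ.abs_eq x.isSelfAdjoint,
    ENNReal.toReal_add x.posPart_lt_top.ne x.negPart_lt_top.ne]
  unfold traceFun
  have h1 : 0 ≤ (τ.toFun (val τ x)⁺).toReal := ENNReal.toReal_nonneg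
  have h2 : 0 ≤ (τ.toFun (val τ x)⁻).toReal := ENNReal.toReal_nonneg
  rw [abs_le]; constructor <;> linarith

/-- `traceFun` as an additive map. -/
noncomputable def traceHom : τ.PreL1 →+ ℝ := AddMonoidHom.mk' traceFun traceFun_add

theorem continuous_traceHom : Continuous (traceHom : τ.PreL1 →+ ℝ) :=
  AddMonoidHomClass.continuous_of_bound traceHom 1 fun x => by
    rw [one_mul]; exact abs_traceFun_le x

variable (τ) in
/-- The trace as a bounded real-linear functional on `PreL1`. -/
noncomputable def trace : τ.PreL1 →L[ℝ] ℝ := traceHom.toRealLinearMap continuous_traceHom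

end PreL1

/-- The space `L₁(M_sa, τ)`: the completion of the space of all self-adjoint `x` in `M` with
`τ |x| < ∞` with respect to the norm `‖x‖₁ = τ |x|`. -/
abbrev L1sa : Type _ := UniformSpace.Completion τ.PreL1

namespace L1sa

/-- The trace on `L₁(M_sa, τ)`, extended by continuity. Under the duality
`L₁(M_sa, τ)* = M_sa`, in which `a` acts by `x ↦ τ (x a)`, it is the unit of `M`. -/
noncomputable def trace : StrongDual ℝ τ.L1sa := (PreL1.trace τ).fromCompletion

variable {τ}

/-- The positive cone of `L₁(M_sa, τ)`: the `‖·‖₁`-closure of the positive `x` in `M` with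
`τ x < ∞`. -/
def IsPos (x : τ.L1sa) : Prop :=
  x ∈ closure ((fun y : τ.PreL1 => (y : τ.L1sa)) '' {y | 0 ≤ PreL1.val τ y})

/-- A positive operator maps positive elements to positive elements. -/
def PosOp (T : τ.L1sa →L[ℝ] τ.L1sa) : Prop := ∀ x, IsPos x → IsPos (T x)

/-- The order on operators: `A ≤ B` if `B - A` is positive. -/
def OpLE (A B : τ.L1sa →L[ℝ] τ.L1sa) : Prop := PosOp (B - A)

/-- A positive contraction. -/
def PosContraction (T : τ.L1sa →L[ℝ] τ.L1sa) : Prop := PosOp T ∧ ∀ x, ‖T x‖ ≤ ‖x‖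

/-- The conjugate operator `T* f = f ∘ T` on the dual space. -/
noncomputable def conj (T : τ.L1sa →L[ℝ] τ.L1sa) (f : StrongDual ℝ τ.L1sa) :
    StrongDual ℝ τ.L1sa := f.comp T

/-- A unital positive contraction: a positive contraction with `T* 1 = 1`. -/
def UnitalPosContraction (T : τ.L1sa →L[ℝ] τ.L1sa) : Prop :=
  PosContraction T ∧ conj T (trace τ) = trace τ

/-- `T^n = T₁^{n₁} ⋯ T_d^{n_d}` for a multi-index `n`. -/
noncomputable def multiPow {d : ℕ} (T : Fin d → (τ.L1sa →L[ℝ] τ.L1sa)) (n : Fin d → ℕ) :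
    τ.L1sa →L[ℝ] τ.L1sa := (List.ofFn fun i => T i ^ n i).prod

end L1sa

end FNSTrace

/-! ### Powers of averages of a contraction -/

section Averages

/-! Put `U = T^k`, `A = Z T^(m+k)` and `W = (1 + U) / 2`. Since `U Z T^m = A`, averaging the two
domination hypotheses gives `A = W (Z S) + R` with `R` positive and `‖R‖ < 1`. Iterating, `A^l = W V
+ R^l` with `V` positive. The unital operators preserve the trace, and on the positive cone the
trace is the norm, so `V` is a contraction however large `l` is, while `R^l → 0`
(`exists_norm_le_one_pow_eq`). Hence `A^(l p)` is close to `W^p V^p`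
(`norm_pow_sub_pow_mul_pow_le`). For any contraction `U`, `‖(U - 1) W^p‖ → 0` as `p` runs through
the even numbers: expanding `W^p` binomially, the norm is at most the total variation of the
normalized binomial coefficients, of order `p^(-1/2)` (`norm_sub_one_mul_average_pow_le`). So `(U -
1) A^N` is small for some `N`. This operator is `Z^N (T^(n+k) - T^n)` at `n = N (m + k)`, and larger
`n` only add a contractive factor. -/

theorem centralBinom_sq_mul_le (n : ℕ) : n.centralBinom ^ 2 * (2 * n + 1) ≤ 16 ^ n := by
  induction n with
  | zero => simp
  | succ n ih =>
    have h := Nat.succ_mul_centralBinom_succ n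
    have h1 : (n + 1) ^ 2 * ((n + 1).centralBinom ^ 2 * (2 * (n + 1) + 1)) ≤
        (n + 1) ^ 2 * 16 ^ (n + 1) := by
      calc (n + 1) ^ 2 * ((n + 1).centralBinom ^ 2 * (2 * (n + 1) + 1))
          = ((n + 1) * (n + 1).centralBinom) ^ 2 * (2 * n + 3) := by ring
        _ = (n.centralBinom ^ 2 * (2 * n + 1)) * (4 * (2 * n + 1) * (2 * n + 3)) := by
            rw [h]; ring
        -- The point is `(2n+1)(2n+3) ≤ (2n+2)^2`.
        _ ≤ 16 ^ n * (16 * (n + 1) ^ 2) := Nat.mul_le_mul ih (by nlinarith)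
        _ = (n + 1) ^ 2 * 16 ^ (n + 1) := by ring
    exact Nat.le_of_mul_le_mul_left h1 (by positivity)

theorem tendsto_centralBinom_div_four_pow :
    Filter.Tendsto (fun n : ℕ => (n.centralBinom : ℝ) / 4 ^ n) Filter.atTop (nhds 0) := by
  have h1 : Filter.Tendsto (fun n : ℕ => √(1 / ((n : ℝ) + 1))) Filter.atTop (nhds 0) := by
    have h := (Real.continuous_sqrt.tendsto 0).comp
      (tendsto_one_div_add_atTop_nhds_zero_nat (𝕜 := ℝ))
    rwa [Real.sqrt_zero] at h
  refine squeeze_zero (fun n => by positivity) (fun n => Real.le_sqrt_of_sq_le ?_) h1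
  have h2 : (n.centralBinom : ℝ) ^ 2 * (2 * n + 1) ≤ 16 ^ n := by
    exact_mod_cast centralBinom_sq_mul_le n
  have h3 : ((4 : ℝ) ^ n) ^ 2 = 16 ^ n := by rw [← pow_mul, mul_comm, pow_mul]; norm_num
  rw [div_pow, h3, div_le_div_iff₀ (by positivity) (by positivity)]
  nlinarith [sq_nonneg (n.centralBinom : ℝ), (Nat.cast_nonneg n : (0 : ℝ) ≤ n),
    mul_nonneg (sq_nonneg (n.centralBinom : ℝ)) (Nat.cast_nonneg n : (0 : ℝ) ≤ n)]

variable {R : Type*} [NormedRing R]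

/-- Assuming `‖1‖ ≤ 1` rather than `‖1‖ = 1` covers operators on the zero space. -/
theorem norm_pow_le_one_of_norm_le_one (h1 : ‖(1 : R)‖ ≤ 1) {u : R} (hu : ‖u‖ ≤ 1) (n : ℕ) :
    ‖u ^ n‖ ≤ 1 := by
  induction n with
  | zero => simpa using h1
  | succ n ih =>
    rw [pow_succ]
    exact (norm_mul_le _ _).trans (mul_le_one₀ ih (norm_nonneg _) hu)

/-- If `a` is, up to an error of norm at most `δ`, divisible by `w` on the left with a contractive
quotient, then `a ^ p` is divisible by `w ^ p` in this sense up to an error of norm `p * δ`. -/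
theorem norm_pow_sub_pow_mul_pow_le (h1 : ‖(1 : R)‖ ≤ 1) {a w v : R} (ha : ‖a‖ ≤ 1)
    (hw : ‖w‖ ≤ 1) (hv : ‖v‖ ≤ 1) (haw : Commute a w) {δ : ℝ} (h : ‖a - w * v‖ ≤ δ) (p : ℕ) :
    ‖a ^ p - w ^ p * v ^ p‖ ≤ p * δ := by
  induction p with
  | zero => simp
  | succ p ih =>
    have hδ : 0 ≤ δ := (norm_nonneg _).trans h
    -- One factor `a` is replaced at a time. Only `a` and `w` need to commute, because powers of `v`
    -- stay on the right.
    have e : a ^ (p + 1) - w ^ (p + 1) * v ^ (p + 1) =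
        a * (a ^ p - w ^ p * v ^ p) + w ^ p * ((a - w * v) * v ^ p) := by
      have : a * w ^ p = w ^ p * a := (haw.pow_right p).eq
      rw [pow_succ' a, pow_succ w, pow_succ' v, mul_sub, ← mul_assoc a, this]
      noncomm_ring
    rw [e]
    have b1 : ‖a * (a ^ p - w ^ p * v ^ p)‖ ≤ p * δ :=
      (norm_mul_le _ _).trans ((mul_le_of_le_one_left (norm_nonneg _) ha).trans ih)
    have b2 : ‖w ^ p * ((a - w * v) * v ^ p)‖ ≤ δ :=
      (norm_mul_le _ _).trans <| (mul_le_of_le_one_left (norm_nonneg _)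
        (norm_pow_le_one_of_norm_le_one h1 hw p)).trans <| (norm_mul_le _ _).trans <|
        (mul_le_of_le_one_right (norm_nonneg _) (norm_pow_le_one_of_norm_le_one h1 hv p)).trans h
    calc _ ≤ p * δ + δ := (norm_add_le _ _).trans (add_le_add b1 b2)
      _ = _ := by push_cast; ring

variable [NormedAlgebra ℝ R]

/-- Summation by parts: it moves the difference from the powers of `u` to the coefficients. -/
theorem sub_one_mul_sum_smul_pow (a : ℕ → ℝ) (u : R) (p : ℕ) :
    (u - 1) * ∑ j ∈ Finset.range (p + 1), a j • u ^ j =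
      a p • u ^ (p + 1) - a 0 • (1 : R) +
        ∑ j ∈ Finset.range p, (a j - a (j + 1)) • u ^ (j + 1) := by
  induction p with
  | zero => simp [smul_sub]
  | succ p ih =>
    rw [Finset.sum_range_succ, mul_add, ih, Finset.sum_range_succ _ p, sub_mul, one_mul,
      mul_smul_comm, ← pow_succ', sub_smul]
    abel

theorem norm_sub_one_mul_sum_smul_pow_le (h1 : ‖(1 : R)‖ ≤ 1) {u : R} (hu : ‖u‖ ≤ 1)
    (a : ℕ → ℝ) (p : ℕ) :
    ‖(u - 1) * ∑ j ∈ Finset.range (p + 1), a j • u ^ j‖ ≤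
      |a p| + |a 0| + ∑ j ∈ Finset.range p, |a j - a (j + 1)| := by
  have hsmul (c : ℝ) (n : ℕ) : ‖c • u ^ n‖ ≤ |c| := by
    rw [norm_smul, Real.norm_eq_abs]
    exact mul_le_of_le_one_right (abs_nonneg c) (norm_pow_le_one_of_norm_le_one h1 hu n)
  rw [sub_one_mul_sum_smul_pow]
  refine (norm_add_le _ _).trans (add_le_add ((norm_sub_le _ _).trans (add_le_add ?_ ?_)) ?_)
  · exact hsmul _ _
  · simpa using hsmul (a 0) 0
  · exact norm_sum_le_of_le _ fun j _ => hsmul _ _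

/-- The row is unimodal, so the sum telescopes on each side of the peak `q.centralBinom`, climbing
from 1 and descending to 1. -/
theorem sum_abs_choose_sub_choose (q : ℕ) :
    ∑ j ∈ Finset.range (2 * q), |((2 * q).choose j : ℝ) - ((2 * q).choose (j + 1) : ℝ)| =
      2 * (q.centralBinom : ℝ) - 2 := by
  have hsplit : 2 * q = q + q := two_mul q
  have hinc : ∀ j < q, (2 * q).choose j ≤ (2 * q).choose (j + 1) := fun j hj =>
    Nat.choose_le_succ_of_lt_half_left (by omega)
  have hdec : ∀ j < q, (2 * q).choose (q + j + 1) ≤ (2 * q).choose (q + j) := by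
    intro j hj
    -- The descending half is the mirror image of the ascending one under `i ↦ 2q - i`.
    have h := hinc (q - 1 - j) (by omega)
    rw [← Nat.choose_symm (by omega : q + j + 1 ≤ 2 * q),
      ← Nat.choose_symm (by omega : q + j ≤ 2 * q)]
    convert h using 2 <;> omega
  have hleft : ∑ j ∈ Finset.range q,
      |((2 * q).choose j : ℝ) - ((2 * q).choose (j + 1) : ℝ)| = q.centralBinom - 1 := by
    rw [Finset.sum_congr rfl fun j hj => by
      rw [abs_sub_comm, abs_of_nonneg
        (sub_nonneg.2 (Nat.cast_le.2 (hinc j (Finset.mem_range.1 hj))))],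
      Finset.sum_range_sub (fun j => ((2 * q).choose j : ℝ))]
    simp [Nat.centralBinom]
  have hright : ∑ j ∈ Finset.range q,
      |((2 * q).choose (q + j) : ℝ) - ((2 * q).choose (q + j + 1) : ℝ)| =
        q.centralBinom - 1 := by
    rw [Finset.sum_congr rfl fun j hj => by
      rw [abs_of_nonneg (sub_nonneg.2 (Nat.cast_le.2 (hdec j (Finset.mem_range.1 hj)))), add_assoc],
      Finset.sum_range_sub' (fun j => ((2 * q).choose (q + j) : ℝ))]
    simp [Nat.centralBinom, ← two_mul]
  have h : ∑ j ∈ Finset.range (q + q),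
      |((2 * q).choose j : ℝ) - ((2 * q).choose (j + 1) : ℝ)| = 2 * (q.centralBinom : ℝ) - 2 := by
    rw [Finset.sum_range_add, hleft, hright]; ring
  rwa [← hsplit] at h

theorem norm_sub_one_mul_average_pow_le (h1 : ‖(1 : R)‖ ≤ 1) {u : R} (hu : ‖u‖ ≤ 1) (q : ℕ) :
    ‖(u - 1) * ((1 / 2 : ℝ) • (1 + u)) ^ (2 * q)‖ ≤ 2 * ((q.centralBinom : ℝ) / 4 ^ q) := by
  have hexp : (1 + u) ^ (2 * q) =
      ∑ j ∈ Finset.range (2 * q + 1), ((2 * q).choose j : ℝ) • u ^ j := by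
    rw [add_comm, (Commute.one_right u).add_pow]
    refine Finset.sum_congr rfl fun j _ => ?_
    rw [one_pow, mul_one, ← (Nat.cast_commute _ _).eq, Nat.cast_smul_eq_nsmul, nsmul_eq_mul]
  have h := norm_sub_one_mul_sum_smul_pow_le h1 hu (fun j => ((2 * q).choose j : ℝ)) (2 * q)
  rw [sum_abs_choose_sub_choose, ← hexp] at h
  rw [smul_pow, mul_smul_comm, norm_smul]
  have h4 : ‖(1 / 2 : ℝ) ^ (2 * q)‖ = ((4 : ℝ) ^ q)⁻¹ := by
    rw [pow_mul, norm_pow, ← inv_pow]; norm_num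
  -- The two end coefficients, each equal to 1, cancel the `- 2` of the total variation.
  have h5 : ‖(u - 1) * (1 + u) ^ (2 * q)‖ ≤ 2 * q.centralBinom := by
    simp only [Nat.choose_self, Nat.choose_zero_right, Nat.cast_one, abs_one] at h
    linarith
  rw [h4]
  calc ((4 : ℝ) ^ q)⁻¹ * ‖(u - 1) * (1 + u) ^ (2 * q)‖
      ≤ ((4 : ℝ) ^ q)⁻¹ * (2 * q.centralBinom) := by gcongr
    _ = _ := by ring

theorem exists_norm_sub_one_mul_average_pow_lt (h1 : ‖(1 : R)‖ ≤ 1) {u : R} (hu : ‖u‖ ≤ 1)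
    {ε : ℝ} (hε : 0 < ε) : ∃ p : ℕ, 1 ≤ p ∧ ‖(u - 1) * ((1 / 2 : ℝ) • (1 + u)) ^ p‖ < ε := by
  have h := (tendsto_centralBinom_div_four_pow.const_mul 2).eventually
    (gt_mem_nhds (by simpa using hε : 2 * (0 : ℝ) < ε))
  obtain ⟨q, hq, hq1⟩ := (h.and (Filter.eventually_ge_atTop 1)).exists
  exact ⟨2 * q, by omega, (norm_sub_one_mul_average_pow_le h1 hu q).trans_lt hq⟩

end Averages

/-! ### Products over commuting families -/

theorem List.prod_ofFn_mul_of_commute {A : Type*} [Monoid A] {d : ℕ} (f g : Fin d → A)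
    (h : ∀ i j, Commute (f i) (g j)) :
    (List.ofFn fun i => f i * g i).prod = (List.ofFn f).prod * (List.ofFn g).prod := by
  induction d with
  | zero => simp
  | succ d ih =>
    have hc : Commute (List.ofFn fun i : Fin d => f i.succ).prod (g 0) :=
      Commute.list_prod_left _ _ fun x hx => by
        obtain ⟨i, rfl⟩ := (List.mem_ofFn' _ _).1 hx
        exact h _ _
    simp only [List.ofFn_succ, List.prod_cons]
    rw [ih (fun i => f i.succ) (fun i => g i.succ) fun i j => h _ _]
    simp only [mul_assoc]
    rw [← mul_assoc (g 0), ← hc.eq]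
    simp only [mul_assoc]

namespace FNSTrace

variable {M : Type*} [CStarAlgebra M] [PartialOrder M] [StarOrderedRing M] {τ : FNSTrace M}

/-! ### The positive cone and positive operators -/

namespace PreL1

theorem trace_apply (y : τ.PreL1) : trace τ y = traceFun y := rfl

theorem norm_eq_trace {y : τ.PreL1} (hy : 0 ≤ val τ y) : ‖y‖ = trace τ y := by
  rw [norm_def, CFC.abs_of_nonneg _ hy, trace_apply,
    traceFun_eq y hy le_rfl (by simpa [CFC.abs_of_nonneg _ hy] using y.abs_lt_top)
      (by rw [τ.map_zero]; exact ENNReal.zero_lt_top) (sub_zero _).symm, τ.map_zero]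
  simp

/-- Every element is a difference of positive ones whose norms add up. -/
theorem exists_nonneg_sub_nonneg (y : τ.PreL1) :
    ∃ a b : τ.PreL1, 0 ≤ val τ a ∧ 0 ≤ val τ b ∧ y = a - b ∧ ‖y‖ = ‖a‖ + ‖b‖ := by
  have hp := CFC.posPart_nonneg (val τ y)
  have hn := CFC.negPart_nonneg (val τ y)
  let a : τ.PreL1 := ⟨(val τ y)⁺, .of_nonneg hp, by
    rw [CFC.abs_of_nonneg _ hp]; exact y.posPart_lt_top⟩
  let b : τ.PreL1 := ⟨(val τ y)⁻, .of_nonneg hn, by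
    rw [CFC.abs_of_nonneg _ hn]; exact y.negPart_lt_top⟩
  have ha : val τ a = (val τ y)⁺ := rfl
  have hb : val τ b = (val τ y)⁻ := rfl
  refine ⟨a, b, ha ▸ hp, hb ▸ hn, ?_, ?_⟩
  · apply Subtype.val_injective
    exact (CFC.posPart_sub_negPart (val τ y) y.isSelfAdjoint).symm
  · rw [norm_def, norm_def, norm_def, ha, hb, CFC.abs_of_nonneg _ hp, CFC.abs_of_nonneg _ hn,
      τ.abs_eq y.isSelfAdjoint, ENNReal.toReal_add y.posPart_lt_top.ne y.negPart_lt_top.ne]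

end PreL1

namespace L1sa

theorem trace_coe (y : τ.PreL1) : trace τ (y : τ.L1sa) = PreL1.trace τ y :=
  ContinuousLinearMap.fromCompletion_apply_coe _ _

theorem isPos_coe {y : τ.PreL1} (hy : 0 ≤ PreL1.val τ y) : IsPos (y : τ.L1sa) :=
  subset_closure ⟨y, hy, rfl⟩

/-- The norm is thus additive on the cone, which lets trace identities control operator norms. Both
sides are continuous, so the identity passes to the closure. -/
theorem IsPos.norm_eq_trace {x : τ.L1sa} (hx : IsPos x) : ‖x‖ = trace τ x := by
  have hc : IsClosed {x : τ.L1sa | ‖x‖ = trace τ x} :=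
    isClosed_eq continuous_norm (trace τ).continuous
  refine closure_minimal ?_ hc hx
  rintro _ ⟨y, hy, rfl⟩
  change ‖(y : τ.L1sa)‖ = trace τ (y : τ.L1sa)
  rw [UniformSpace.Completion.norm_coe, trace_coe, PreL1.norm_eq_trace hy]

theorem IsPos.add {x y : τ.L1sa} (hx : IsPos x) (hy : IsPos y) : IsPos (x + y) := by
  refine map_mem_closure₂ continuous_add hx hy ?_
  rintro _ ⟨a, ha, rfl⟩ _ ⟨b, hb, rfl⟩
  refine ⟨a + b, ?_, UniformSpace.Completion.coe_add a b⟩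
  change 0 ≤ PreL1.val τ (a + b)
  rw [_root_.map_add]
  exact add_nonneg ha hb

theorem IsPos.smul {x : τ.L1sa} (hx : IsPos x) {c : ℝ} (hc : 0 ≤ c) : IsPos (c • x) := by
  refine map_mem_closure (continuous_const_smul c) hx ?_
  rintro _ ⟨a, ha, rfl⟩
  refine ⟨c • a, ?_, UniformSpace.Completion.coe_smul c a⟩
  change 0 ≤ PreL1.val τ (c • a)
  rw [_root_.map_smul]
  exact smul_nonneg hc ha

theorem posOp_zero : PosOp (0 : τ.L1sa →L[ℝ] τ.L1sa) := fun x hx => by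
  simpa using hx.smul le_rfl

theorem posOp_one : PosOp (1 : τ.L1sa →L[ℝ] τ.L1sa) := fun _ hx => hx

theorem PosOp.add {A B : τ.L1sa →L[ℝ] τ.L1sa} (hA : PosOp A) (hB : PosOp B) : PosOp (A + B) :=
  fun x hx => (hA x hx).add (hB x hx)

theorem PosOp.smul {A : τ.L1sa →L[ℝ] τ.L1sa} (hA : PosOp A) {c : ℝ} (hc : 0 ≤ c) :
    PosOp (c • A) :=
  fun x hx => (hA x hx).smul hc

theorem PosOp.mul {A B : τ.L1sa →L[ℝ] τ.L1sa} (hA : PosOp A) (hB : PosOp B) : PosOp (A * B) :=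
  fun x hx => hA _ (hB x hx)

theorem PosOp.pow {A : τ.L1sa →L[ℝ] τ.L1sa} (hA : PosOp A) (n : ℕ) : PosOp (A ^ n) := by
  induction n with
  | zero => exact posOp_one
  | succ n ih => rw [pow_succ]; exact ih.mul hA

/-- A positive operator which does not increase the trace of positive elements is a contraction. -/
theorem PosOp.norm_le_one {V : τ.L1sa →L[ℝ] τ.L1sa} (hV : PosOp V)
    (h : ∀ x, IsPos x → trace τ (V x) ≤ trace τ x) : ‖V‖ ≤ 1 := by
  have hpos (x : τ.L1sa) (hx : IsPos x) : ‖V x‖ ≤ ‖x‖ := by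
    rw [(hV x hx).norm_eq_trace, hx.norm_eq_trace]
    exact h x hx
  refine V.opNorm_le_bound zero_le_one fun x => ?_
  rw [one_mul]
  induction x using UniformSpace.Completion.induction_on with
  | hp => exact isClosed_le (by fun_prop) (by fun_prop)
  | ih y =>
    -- Because `‖y‖ = ‖a‖ + ‖b‖` exactly, the bound on the cone extends without losing a constant.
    obtain ⟨a, b, ha, hb, hy, hn⟩ := y.exists_nonneg_sub_nonneg
    rw [UniformSpace.Completion.norm_coe, hn, hy, UniformSpace.Completion.coe_sub, map_sub]
    refine (norm_sub_le _ _).trans (add_le_add ?_ ?_)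
    · simpa using hpos _ (isPos_coe ha)
    · simpa using hpos _ (isPos_coe hb)

/-! ### Unital positive contractions -/

theorem UnitalPosContraction.posOp {T : τ.L1sa →L[ℝ] τ.L1sa} (hT : UnitalPosContraction T) :
    PosOp T := hT.1.1

theorem UnitalPosContraction.norm_le_one {T : τ.L1sa →L[ℝ] τ.L1sa}
    (hT : UnitalPosContraction T) : ‖T‖ ≤ 1 :=
  T.opNorm_le_bound zero_le_one fun x => by rw [one_mul]; exact hT.1.2 x

theorem UnitalPosContraction.trace_apply {T : τ.L1sa →L[ℝ] τ.L1sa}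
    (hT : UnitalPosContraction T) (x : τ.L1sa) : trace τ (T x) = trace τ x :=
  DFunLike.congr_fun hT.2 x

theorem unitalPosContraction_of_trace {T : τ.L1sa →L[ℝ] τ.L1sa} (hT : PosOp T)
    (h : ∀ x, trace τ (T x) = trace τ x) : UnitalPosContraction T := by
  refine ⟨⟨hT, fun x => ?_⟩, ContinuousLinearMap.ext h⟩
  exact T.le_of_opNorm_le (hT.norm_le_one fun x _ => (h x).le) x |>.trans_eq (one_mul _)

theorem unitalPosContraction_one : UnitalPosContraction (1 : τ.L1sa →L[ℝ] τ.L1sa) :=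
  unitalPosContraction_of_trace posOp_one fun _ => rfl

theorem UnitalPosContraction.mul {A B : τ.L1sa →L[ℝ] τ.L1sa} (hA : UnitalPosContraction A)
    (hB : UnitalPosContraction B) : UnitalPosContraction (A * B) :=
  unitalPosContraction_of_trace (hA.posOp.mul hB.posOp) fun x =>
    (hA.trace_apply (B x)).trans (hB.trace_apply x)

theorem UnitalPosContraction.pow {A : τ.L1sa →L[ℝ] τ.L1sa} (hA : UnitalPosContraction A)
    (n : ℕ) : UnitalPosContraction (A ^ n) := by
  induction n with
  | zero => exact unitalPosContraction_one
  | succ n ih => rw [pow_succ]; exact ih.mul hA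

theorem UnitalPosContraction.average {U : τ.L1sa →L[ℝ] τ.L1sa} (hU : UnitalPosContraction U) :
    UnitalPosContraction ((1 / 2 : ℝ) • (1 + U)) := by
  refine unitalPosContraction_of_trace ((posOp_one.add hU.posOp).smul (by norm_num)) fun x => ?_
  change trace τ ((1 / 2 : ℝ) • (x + U x)) = trace τ x
  rw [_root_.map_smul, _root_.map_add, hU.trace_apply, smul_eq_mul]
  ring

theorem unitalPosContraction_list_prod (l : List (τ.L1sa →L[ℝ] τ.L1sa))
    (h : ∀ T ∈ l, UnitalPosContraction T) : UnitalPosContraction l.prod := by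
  induction l with
  | nil => exact unitalPosContraction_one
  | cons T l ih =>
    rw [List.prod_cons]
    exact (h T List.mem_cons_self).mul (ih fun T' hT' => h T' (List.mem_cons_of_mem _ hT'))

/-! ### Multi-index powers of commuting operators. -/

section MultiPow

variable {d : ℕ} {T : Fin d → (τ.L1sa →L[ℝ] τ.L1sa)}

theorem unitalPosContraction_multiPow (hT : ∀ i, UnitalPosContraction (T i)) (n : Fin d → ℕ) :
    UnitalPosContraction (multiPow T n) := by
  refine unitalPosContraction_list_prod _ fun A hA => ?_
  obtain ⟨i, rfl⟩ := (List.mem_ofFn' _ _).1 hA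
  exact (hT i).pow _

theorem commute_multiPow {Z : τ.L1sa →L[ℝ] τ.L1sa} (hZ : ∀ i, Commute Z (T i))
    (n : Fin d → ℕ) : Commute Z (multiPow T n) := by
  refine Commute.list_prod_right _ _ fun A hA => ?_
  obtain ⟨i, rfl⟩ := (List.mem_ofFn' _ _).1 hA
  exact (hZ i).pow_right _

theorem multiPow_add (hTT : ∀ i j, Commute (T i) (T j)) (n n' : Fin d → ℕ) :
    multiPow T (n + n') = multiPow T n * multiPow T n' := by
  unfold multiPow
  rw [← List.prod_ofFn_mul_of_commute _ _ fun i j => (hTT i j).pow_pow _ _]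
  simp only [Pi.add_apply, pow_add]

theorem multiPow_nsmul (hTT : ∀ i j, Commute (T i) (T j)) (N : ℕ) (n : Fin d → ℕ) :
    multiPow T (N • n) = multiPow T n ^ N := by
  induction N with
  | zero => simp [multiPow]
  | succ N ih => rw [succ_nsmul, multiPow_add hTT, ih, pow_succ]

end MultiPow

/-! ### Divisibility of powers by an average -/

/-- If `A` is a unital positive contraction commuting with another one `W` and `A = W * C + R`
with `C` and `R` positive, then `A ^ l - R ^ l` is `W` times a contraction. -/
theorem exists_norm_le_one_pow_eq {A W C R : τ.L1sa →L[ℝ] τ.L1sa}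
    (hA : UnitalPosContraction A) (hW : UnitalPosContraction W) (hAW : Commute A W)
    (hC : PosOp C) (hR : PosOp R) (h : A = W * C + R) (l : ℕ) :
    ∃ V : τ.L1sa →L[ℝ] τ.L1sa, ‖V‖ ≤ 1 ∧ A ^ l = W * V + R ^ l := by
  obtain ⟨V, hV, hl⟩ : ∃ V : τ.L1sa →L[ℝ] τ.L1sa, PosOp V ∧ A ^ l = W * V + R ^ l := by
    induction l with
    | zero => exact ⟨0, posOp_zero, by simp⟩
    | succ l ih =>
      obtain ⟨V, hV, hl⟩ := ih
      -- In `A W V + A R^l`, the first `A` is moved past `W` and the second is expanded as `W C +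
      -- R`; `C` need not commute with anything.
      refine ⟨A * V + C * R ^ l, (hA.posOp.mul hV).add (hC.mul (hR.pow l)), ?_⟩
      calc A ^ (l + 1) = A * W * V + A * R ^ l := by rw [pow_succ', hl]; noncomm_ring
        _ = W * A * V + (W * C + R) * R ^ l := by rw [hAW.eq, ← h]
        _ = W * (A * V + C * R ^ l) + R ^ (l + 1) := by rw [pow_succ']; noncomm_ring
  refine ⟨V, hV.norm_le_one fun x hx => ?_, hl⟩
  -- `W` and `A^l` preserve the trace, so `V x` has the trace of `x` minus that of the positive
  -- element `(R^l) x`.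
  have h1 : trace τ ((A ^ l) x) = trace τ (V x) + trace τ ((R ^ l) x) := by
    rw [hl, ← hW.trace_apply (V x), ← _root_.map_add]
    rfl
  rw [(hA.pow l).trace_apply, ← (hR.pow l x hx).norm_eq_trace] at h1
  linarith [norm_nonneg ((R ^ l) x)]

/-- If `A = W * C + R` with `W` the average of `1` and `U`, where `C` and `R` are positive and
`‖R‖ < 1`, then some power of `A` nearly absorbs `U`. -/
theorem exists_norm_sub_one_mul_pow_lt {A U C R : τ.L1sa →L[ℝ] τ.L1sa}
    (hA : UnitalPosContraction A) (hU : UnitalPosContraction U) (hAU : Commute A U)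
    (hC : PosOp C) (hR : PosOp R) (h : A = (1 / 2 : ℝ) • (1 + U) * C + R) (hR1 : ‖R‖ < 1)
    {ε : ℝ} (hε : 0 < ε) : ∃ N : ℕ, 1 ≤ N ∧ ‖(U - 1) * A ^ N‖ < ε := by
  set W : τ.L1sa →L[ℝ] τ.L1sa := (1 / 2 : ℝ) • (1 + U) with hWdef
  have hW : UnitalPosContraction W := hU.average
  have hAW : Commute A W := ((Commute.one_right A).add_right hAU).smul_right _
  have h1 : ‖(1 : τ.L1sa →L[ℝ] τ.L1sa)‖ ≤ 1 := unitalPosContraction_one.norm_le_one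
  obtain ⟨p, hp, hpε⟩ := exists_norm_sub_one_mul_average_pow_lt h1 hU.norm_le_one (half_pos hε)
  have hp0 : (0 : ℝ) < p := by exact_mod_cast hp
  -- The exponent `p` is fixed before `l`: the `p` factors accumulate an error `ε / 4`, which `‖U -
  -- 1‖ ≤ 2` turns into `ε / 2`.
  have hδ : 0 < ε / (4 * p) := by positivity
  obtain ⟨l, hlδ, hl1⟩ := (((tendsto_pow_atTop_nhds_zero_of_lt_one (norm_nonneg R) hR1).eventually
    (gt_mem_nhds hδ)).and (Filter.eventually_ge_atTop 1)).exists
  obtain ⟨V, hV, hl⟩ := exists_norm_le_one_pow_eq hA hW hAW hC hR h l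
  have hclose : ‖A ^ l - W * V‖ ≤ ε / (4 * p) := by
    rw [hl, add_sub_cancel_left]
    exact (norm_pow_le' R hl1).trans hlδ.le
  have hE := norm_pow_sub_pow_mul_pow_le h1 (hA.pow l).norm_le_one hW.norm_le_one hV
    (hAW.pow_left l) hclose p
  have hE' : (p : ℝ) * (ε / (4 * p)) = ε / 4 := by field_simp
  rw [hE', ← pow_mul] at hE
  refine ⟨l * p, Nat.mul_pos hl1 hp, ?_⟩
  have hsub : ‖U - 1‖ ≤ 2 := (norm_sub_le _ _).trans (by linarith [hU.norm_le_one])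
  have e : (U - 1) * A ^ (l * p) =
      (U - 1) * W ^ p * V ^ p + (U - 1) * (A ^ (l * p) - W ^ p * V ^ p) := by noncomm_ring
  rw [e]
  have b1 : ‖(U - 1) * W ^ p * V ^ p‖ < ε / 2 :=
    ((norm_mul_le _ _).trans (mul_le_of_le_one_right (norm_nonneg _)
      (norm_pow_le_one_of_norm_le_one h1 hV p))).trans_lt hpε
  have b2 : ‖(U - 1) * (A ^ (l * p) - W ^ p * V ^ p)‖ ≤ 2 * (ε / 4) :=
    (norm_mul_le _ _).trans (mul_le_mul hsub hE (norm_nonneg _) zero_le_two)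
  linarith [norm_add_le ((U - 1) * W ^ p * V ^ p) ((U - 1) * (A ^ (l * p) - W ^ p * V ^ p))]

end L1sa

end FNSTrace

/-! ### The main theorem. -/

open FNSTrace.L1sa in
theorem theorem4p1 {M : Type*} [CStarAlgebra M] [PartialOrder M] [StarOrderedRing M]
    [WStarAlgebra M] (τ : FNSTrace M) {d : ℕ}
    (Z : τ.L1sa →L[ℝ] τ.L1sa) (T : Fin d → (τ.L1sa →L[ℝ] τ.L1sa))
    (hZ : FNSTrace.L1sa.UnitalPosContraction Z)
    (hT : ∀ i, FNSTrace.L1sa.UnitalPosContraction (T i))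
    (hZT : ∀ i, Z * T i = T i * Z)
    (hTT : ∀ i j, T i * T j = T j * T i)
    (m k : Fin d → ℕ) (S : τ.L1sa →L[ℝ] τ.L1sa)
    (hS : FNSTrace.L1sa.PosContraction S) (hSZ : S * Z = Z * S)
    (hle₁ : FNSTrace.L1sa.OpLE (Z * S) (Z * FNSTrace.L1sa.multiPow T (m + k)))
    (hle₂ : FNSTrace.L1sa.OpLE (Z * S) (Z * FNSTrace.L1sa.multiPow T m))
    (hlt₁ : ‖Z * (FNSTrace.L1sa.multiPow T (m + k) - S)‖ < 1)
    (hlt₂ : ‖Z * (FNSTrace.L1sa.multiPow T m - S)‖ < 1) :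
    ∀ ε : ℝ, 0 < ε → ∃ N : ℕ, 1 ≤ N ∧ ∃ n₀ : Fin d → ℕ, ∀ n : Fin d → ℕ, n₀ ≤ n →
      ‖Z ^ N * (FNSTrace.L1sa.multiPow T (n + k) - FNSTrace.L1sa.multiPow T n)‖ < ε := by
  intro ε hε
  have hTm (n : Fin d → ℕ) := unitalPosContraction_multiPow hT n
  have hcT (i : Fin d) (n : Fin d → ℕ) : Commute (T i) (multiPow T n) :=
    commute_multiPow (fun j => hTT i j) n
  have hcTT (n n' : Fin d → ℕ) : Commute (multiPow T n) (multiPow T n') :=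
    commute_multiPow (fun i => (hcT i n).symm) n'
  have hcZ (n : Fin d → ℕ) : Commute Z (multiPow T n) := commute_multiPow hZT n
  set U := multiPow T k with hUdef
  have hU : UnitalPosContraction U := hTm k
  set Q₁ := Z * multiPow T (m + k) - Z * S with hQ₁
  set Q₂ := Z * multiPow T m - Z * S with hQ₂
  have hQ₁n : ‖Q₁‖ < 1 := by rwa [hQ₁, ← mul_sub]
  have hQ₂n : ‖Q₂‖ < 1 := by rwa [hQ₂, ← mul_sub]
  have hUQ₂n : ‖U * Q₂‖ < 1 := ((norm_mul_le _ _).trans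
    (mul_le_of_le_one_left (norm_nonneg _) hU.norm_le_one)).trans_lt hQ₂n
  have hA : UnitalPosContraction (Z * multiPow T (m + k)) := hZ.mul (hTm _)
  have hUB : U * (Z * multiPow T m) = Z * multiPow T (m + k) := by
    rw [← mul_assoc, ← (hcZ k).eq, mul_assoc, ← multiPow_add hTT, add_comm k m]
  -- Average `A = Z S + Q₁` with `A = U (Z T^m) = U (Z S) + U Q₂`.
  have hdecomp : Z * multiPow T (m + k) =
      (1 / 2 : ℝ) • (1 + U) * (Z * S) + (1 / 2 : ℝ) • (Q₁ + U * Q₂) := by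
    rw [hQ₁, hQ₂, mul_sub, hUB, smul_mul_assoc, ← smul_add]
    have : (1 + U) * (Z * S) + (Z * multiPow T (m + k) - Z * S +
        (Z * multiPow T (m + k) - U * (Z * S))) = (2 : ℝ) • (Z * multiPow T (m + k)) := by
      rw [add_mul, one_mul, two_smul]; abel
    rw [this, smul_smul]
    norm_num
  have hRn : ‖(1 / 2 : ℝ) • (Q₁ + U * Q₂)‖ < 1 := by
    rw [norm_smul]
    norm_num
    linarith [norm_add_le Q₁ (U * Q₂)]
  obtain ⟨N, hN, hlt⟩ := exists_norm_sub_one_mul_pow_lt hA hU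
    ((hcZ k).mul_left (hcTT (m + k) k)) (hZ.posOp.mul hS.1)
    ((PosOp.add hle₁ (hU.posOp.mul hle₂)).smul (by norm_num)) hdecomp hRn hε
  refine ⟨N, hN, N • (m + k), fun n hn => ?_⟩
  obtain ⟨r, rfl⟩ : ∃ r, n = N • (m + k) + r := ⟨n - N • (m + k), (add_tsub_cancel_of_le hn).symm⟩
  have hc : Commute (Z ^ N * (multiPow T (N • (m + k)) * multiPow T r)) (U - 1) :=
    (((hcZ k).pow_left N).mul_left ((hcTT _ k).mul_left (hcTT r k))).sub_right
      (Commute.one_right _)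
  -- With `n = N (m + k) + r`, the factor `T^(N (m + k))` joins `Z^N` to form the `N`-th power of `Z
  -- T^(m+k)`, leaving the contraction `T^r`.
  have e : Z ^ N * (multiPow T (N • (m + k) + r + k) - multiPow T (N • (m + k) + r)) =
      (U - 1) * (Z * multiPow T (m + k)) ^ N * multiPow T r := by
    rw [(hcZ (m + k)).mul_pow, ← multiPow_nsmul hTT, multiPow_add hTT _ k, multiPow_add hTT _ r,
      ← hUdef, ← mul_sub_one, ← mul_assoc, hc.eq]
    simp only [mul_assoc]
  rw [e]
  exact ((norm_mul_le _ _).trans (mul_le_of_le_one_right (norm_nonneg _)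
    (hTm r).norm_le_one)).trans_lt hlt
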